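/- For collections $\mathcal A,\mathcal B$ let $\mathsf{S}_1(\mathcal A,\mathcal B)$ denote the statement: for each sequence $(A_n:n<\omega)$ of elements of $\mathcal A$ there are $b_n\in A_n$ $(n<\omega)$ such that $\{b_n:n<\omega\}\in\mathcal B$. For a topological space $Y$ let $\mathcal O$ be the collection of all open covers of $Y$. Let $\Omega$ be the collection of all open $\omega$-covers of $Y$, that is, open covers $\mathcal U$ such that $Y\notin\mathcal U$, but each finite $F\subseteq Y$ is contained in some $U\in\mathcal U$. Let $\Gamma$ be the collection of all open $\gamma$-covers of $Y$, that is, infinite open covers each of whose infinite subsets still covers $Y$. For a topological group $(G,*)$ let $\mathcal O_{nbd}$ be the collection of all covers of $G$ of the form $\mathcal O(U)=\{x*U:x\in G\}$, where $U$ is an open neighborhood of the identity element of $G$. Proposition. Let $(G,*)$ be a $\sigma$-compact $\mathsf{T}_0$ topological group with property $\mathsf{S}_1(\mathcal O_{nbd},\mathcal O)$. Then $G$ has the property $\mathsf{S}_1(\Omega,\Gamma)$, that is, $G$ is a $\gamma$-space. -/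

import Mathlib

/-- The selection principle `S₁(𝒜, ℬ)`: for each sequence `A 0, A 1, …` of elements of `𝒜` one can
pick `b n ∈ A n` for every `n` such that the set `{b n : n < ω}` belongs to `ℬ`. -/
def SelectionS1 {α : Type*} (𝒜 ℬ : Set (Set α)) : Prop :=
  ∀ A : ℕ → Set α, (∀ n, A n ∈ 𝒜) →
    ∃ b : ℕ → α, (∀ n, b n ∈ A n) ∧ Set.range b ∈ ℬ

/-- `𝒪`: the collection of all open covers of `Y`. -/
def openCovers (Y : Type*) [TopologicalSpace Y] : Set (Set (Set Y)) :=
  {𝒰 | (∀ U ∈ 𝒰, IsOpen U) ∧ ⋃₀ 𝒰 = Set.univ}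

/-- `Ω`: the collection of all open `ω`-covers of `Y`, i.e. open covers that do not have `Y` itself
as a member, but such that every finite subset of `Y` is contained in a member. -/
def omegaCovers (Y : Type*) [TopologicalSpace Y] : Set (Set (Set Y)) :=
  {𝒰 | 𝒰 ∈ openCovers Y ∧ Set.univ ∉ 𝒰 ∧ ∀ F : Set Y, F.Finite → ∃ U ∈ 𝒰, F ⊆ U}

/-- `Γ`: the collection of all open `γ`-covers of `Y`, i.e. infinite open covers each of whose
infinite subsets still covers `Y`. -/
def gammaCovers (Y : Type*) [TopologicalSpace Y] : Set (Set (Set Y)) :=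
  {𝒰 | 𝒰 ∈ openCovers Y ∧ 𝒰.Infinite ∧ ∀ 𝒱 ⊆ 𝒰, 𝒱.Infinite → ⋃₀ 𝒱 = Set.univ}

/-- `𝒪(U) = {x * U : x ∈ G}`: the collection of all left translates of `U`. -/
def leftTranslates {G : Type*} [Group G] (U : Set G) : Set (Set G) :=
  Set.range fun x : G => (fun g : G => x * g) '' U

/-- `𝒪_nbd`: the collection of all covers `𝒪(U)`, where `U` is an open neighborhood of the identity
element of the group `G`. -/
def nbdCovers (G : Type*) [Group G] [TopologicalSpace G] : Set (Set (Set G)) :=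
  {𝒰 | ∃ U : Set G, IsOpen U ∧ (1 : G) ∈ U ∧ 𝒰 = leftTranslates U}

/-! A strategy winning the finite-open game on all of `G` yields γ-covers from ω-covers
(`selectionS1_omega_gamma_of_winnable`). Winnable sets are closed under countable unions, so by
σ-compactness a failure occurs on a compact set, which then contains a nonempty compact `B` without
isolated points (`IsCompact.exists_perfect_of_not_winnable`). In `B`, a Cantor scheme with finite
levels defines neighborhoods `U n` such that, whatever translates are chosen, some branch avoids
them all, contradicting the hypothesis. -/

open Set Filter Topology

section FiniteOpenGame

variable {X : Type*} [TopologicalSpace X]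

/-- `σ` is a strategy for the player who, in round `n` of the finite-open game, names a finite set
`σ n U` depending only on the open sets `U i`, `i < n`, answered so far. It wins on `A` if every
point of `A` belongs to all but finitely many of the answers. -/
def WinsOn (σ : ℕ → (ℕ → Set X) → Finset X) (A : Set X) : Prop :=
  (∀ n U V, (∀ i < n, U i = V i) → σ n U = σ n V) ∧
    ∀ U : ℕ → Set X, (∀ n, IsOpen (U n)) → (∀ n, (σ n U : Set X) ⊆ U n) →
      ∀ x ∈ A, ∀ᶠ n in atTop, x ∈ U n

/-- There is a strategy winning the finite-open game on `A`. -/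
def Winnable (A : Set X) : Prop := ∃ σ, WinsOn σ A

theorem Winnable.empty : Winnable (∅ : Set X) :=
  ⟨fun _ _ => ∅, fun _ _ _ _ => rfl, fun _ _ _ _ hx => hx.elim⟩

theorem Winnable.mono {A B : Set X} (hAB : A ⊆ B) (hB : Winnable B) : Winnable A := by
  obtain ⟨σ, h1, h2⟩ := hB
  exact ⟨σ, h1, fun U hU hσ x hx => h2 U hU hσ x (hAB hx)⟩

/-- Strategies on sets `C m (U m)`, chosen after the answer `U m` to a fixed finite set `F`, can be
played simultaneously. -/
theorem Winnable.combine {A : Set X} (F : Finset X) (C : ℕ → Set X → Set X)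
    (hC : ∀ m V, IsOpen V → (F : Set X) ⊆ V → Winnable (C m V))
    (hA : ∀ x ∈ A, ∀ U : ℕ → Set X, (∀ᶠ n in atTop, x ∈ U n) ∨ ∃ m, x ∈ C m (U m)) :
    Winnable A := by
  classical
  -- Strategies are needed for every `V`; the constant `∅` keeps locality unconditional.
  have hC' : ∀ m V, ∃ τ : ℕ → (ℕ → Set X) → Finset X,
      (∀ n U V, (∀ i < n, U i = V i) → τ n U = τ n V) ∧
      (IsOpen V → (F : Set X) ⊆ V → WinsOn τ (C m V)) := by
    intro m V
    by_cases h : IsOpen V ∧ (F : Set X) ⊆ V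
    · obtain ⟨τ, hτ⟩ := hC m V h.1 h.2
      exact ⟨τ, hτ.1, fun _ _ => hτ⟩
    · exact ⟨fun _ _ => ∅, fun _ _ _ _ => rfl, fun h1 h2 => (h ⟨h1, h2⟩).elim⟩
  choose τ hloc hτ using hC'
  -- The strategy for `C m (U m)` starts in round `m + 1`, once `U m` is known, and sees only later
  -- answers.
  refine ⟨fun n U => F ∪ (Finset.range n).biUnion
    fun m => τ m (U m) (n - (m + 1)) (fun i => U (m + 1 + i)), ?_, ?_⟩
  · intro n U V hUV
    dsimp only
    congr 1
    refine Finset.biUnion_congr rfl fun m hm => ?_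
    rw [Finset.mem_range] at hm
    rw [hUV m hm]
    exact hloc _ _ _ _ _ fun i hi => hUV _ (by omega)
  · intro U hU hσ x hx
    have hF : ∀ n, (F : Set X) ⊆ U n := fun n y hy =>
      hσ n (by simp only [Finset.coe_union]; exact Or.inl hy)
    rcases hA x hx U with h | ⟨m, hm⟩
    · exact h
    · have := (hτ m (U m) (hU m) (hF m)).2 (fun i => U (m + 1 + i)) (fun i => hU _) ?_ x hm
      · rw [eventually_atTop] at this ⊢
        obtain ⟨N, hN⟩ := this
        refine ⟨m + 1 + N, fun n hn => ?_⟩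
        have h := hN (n - (m + 1)) (by omega)
        rwa [show m + 1 + (n - (m + 1)) = n by omega] at h
      · intro n y hy
        refine hσ (m + 1 + n) ?_
        simp only [Finset.coe_union, Finset.coe_biUnion]
        refine Or.inr (mem_iUnion₂.2 ⟨m, by simp; omega, ?_⟩)
        rwa [show m + 1 + n - (m + 1) = n by omega]

theorem Winnable.iUnion {A : ℕ → Set X} (hA : ∀ n, Winnable (A n)) : Winnable (⋃ n, A n) :=
  Winnable.combine ∅ (fun m _ => A m) (fun m _ _ _ => hA m)
    fun _ hx _ => Or.inr (mem_iUnion.1 hx)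

theorem Winnable.union {A B : Set X} (hA : Winnable A) (hB : Winnable B) : Winnable (A ∪ B) := by
  rw [union_eq_iUnion]
  refine Winnable.combine ∅ (fun m _ => bif m = 0 then A else B) (fun m _ _ _ => ?_) ?_
  · by_cases h : m = 0 <;> simpa [h]
  · intro x hx U
    obtain ⟨b, hb⟩ := mem_iUnion.1 hx
    exact Or.inr ⟨if b then 0 else 1, by cases b <;> simpa using hb⟩

/-- Name `x` every round: a point missed by an answer `V` lies in `A \ V`, where a winning strategy
is available. -/
theorem Winnable.of_sdiff_open {A : Set X} (x : X)
    (h : ∀ V, IsOpen V → x ∈ V → Winnable (A \ V)) : Winnable A := by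
  refine Winnable.combine {x} (fun _ V => A \ V) (fun _ V hV hx => h V hV (by simpa using hx)) ?_
  intro y hy U
  by_cases hU : ∀ n, y ∈ U n
  · exact Or.inl (Eventually.of_forall hU)
  · obtain ⟨m, hm⟩ := not_forall.1 hU
    exact Or.inr ⟨m, hy, hm⟩

theorem IsCompact.winnable_of_locally {K : Set X} (hK : IsCompact K)
    (h : ∀ x ∈ K, ∃ N ∈ 𝓝 x, Winnable (N ∩ K)) : Winnable K := by
  refine hK.induction_on Winnable.empty (fun _ _ hst ht => ht.mono hst)
    (fun _ _ hs ht => hs.union ht) fun x hx => ?_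
  obtain ⟨N, hN, hW⟩ := h x hx
  exact ⟨N ∩ K, inter_mem (mem_nhdsWithin_of_mem_nhds hN) self_mem_nhdsWithin, hW⟩

/-- A compact set on which the finite-open game cannot be won contains a nonempty compact set
without isolated points. -/
theorem IsCompact.exists_perfect_of_not_winnable [RegularSpace X] {K : Set X} (hK : IsCompact K)
    (hW : ¬ Winnable K) :
    ∃ B : Set X, IsCompact B ∧ B.Nonempty ∧
      ∀ O, IsOpen O → ∀ x ∈ O ∩ B, ∃ y ∈ O ∩ B, y ≠ x := by
  refine ⟨K ∩ {x | ∀ N ∈ 𝓝 x, ¬ Winnable (N ∩ K)}, hK.inter_right ?_, ?_, ?_⟩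
  · rw [← isOpen_compl_iff, isOpen_iff_mem_nhds]
    intro x hx
    simp only [mem_compl_iff, mem_ofPred_eq, not_forall, not_not] at hx
    obtain ⟨N, hN, hNW⟩ := hx
    filter_upwards [eventually_mem_nhds_iff.2 hN] with y hy hy'
    exact hy' N hy hNW
  · by_contra hB
    refine hW (hK.winnable_of_locally fun x hx => ?_)
    by_contra! h
    exact hB ⟨x, hx, h⟩
  · rintro O hO x ⟨hxO, hxK, hx⟩
    by_contra! h
    obtain ⟨N, hN, hNc, hNO⟩ := exists_mem_nhds_isClosed_subset (hO.mem_nhds hxO)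
    -- If `x` is the only point of the kernel in `O`, the compact set left after removing `V` is
    -- locally winnable.
    refine hx N hN (Winnable.of_sdiff_open x fun V hV hxV => ?_)
    refine IsCompact.winnable_of_locally ((hK.inter_left hNc).diff hV) fun y hy => ?_
    by_contra! hy'
    refine hy.2 ((h y ⟨hNO hy.1.1, hy.1.2, fun M hM hMW => hy' M hM (hMW.mono ?_)⟩) ▸ hxV)
    exact inter_subset_inter_right _ (sdiff_subset.trans inter_subset_right)

/-- The answers `pick n F` to the finite sets `F` named by the strategy `σ`. -/
noncomputable def playAgainst (σ : ℕ → (ℕ → Set X) → Finset X) (pick : ℕ → Finset X → Set X) :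
    ℕ → Set X
  | n => pick n (σ n fun i => if _h : i < n then playAgainst σ pick i else ∅)

theorem selectionS1_omega_gamma_of_winnable (h : Winnable (univ : Set X)) :
    SelectionS1 (omegaCovers X) (gammaCovers X) := by
  intro A hA
  obtain ⟨σ, hloc, hσ⟩ := h
  have hpick : ∀ n (F : Finset X), ∃ U ∈ A n, (F : Set X) ⊆ U :=
    fun n F => (hA n).2.2 F F.finite_toSet
  choose pick hpickA hpickF using hpick
  set U := playAgainst σ pick with hUdef
  have hU : ∀ n, U n = pick n (σ n U) := by
    intro n
    rw [hUdef, playAgainst]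
    congr 1
    exact hloc _ _ _ fun i hi => by simp [hi]
  have hUA : ∀ n, U n ∈ A n := fun n => by rw [hU]; exact hpickA _ _
  have hUo : ∀ n, IsOpen (U n) := fun n => (hA n).1.1 _ (hUA n)
  have hev : ∀ x, ∀ᶠ n in atTop, x ∈ U n := fun x =>
    hσ U hUo (fun n => (hpickF n _).trans (hU n).ge) x (mem_univ x)
  have hcover : ∀ 𝒱 ⊆ range U, 𝒱.Infinite → ⋃₀ 𝒱 = univ := by
    intro 𝒱 h𝒱 hinf
    refine eq_univ_of_forall fun x => ?_
    obtain ⟨N, hN⟩ := eventually_atTop.1 (hev x)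
    obtain ⟨V, hV, hVN⟩ := hinf.exists_notMem_finite ((finite_Iio N).image U)
    obtain ⟨n, rfl⟩ := h𝒱 hV
    refine ⟨U n, hV, hN n ?_⟩
    by_contra hn
    exact hVN ⟨n, not_le.1 hn, rfl⟩
  -- A value repeated infinitely often would contain every point, but ω-covers exclude `univ`.
  have hinf : (range U).Infinite := by
    intro hfin
    have : Finite (range U) := hfin
    obtain ⟨⟨V, hV⟩, hinfin⟩ := Finite.exists_infinite_fiber (rangeFactorization U)
    have hVinf : {n | U n = V}.Infinite := by
      refine (infinite_coe_iff.1 hinfin).mono fun n hn => ?_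
      exact congrArg Subtype.val (show rangeFactorization U n = ⟨V, hV⟩ from hn)
    have hVuniv : V = univ := eq_univ_of_forall fun x => by
      obtain ⟨N, hN⟩ := eventually_atTop.1 (hev x)
      obtain ⟨n, hn, hNn⟩ := hVinf.exists_gt N
      exact hn ▸ hN n hNn.le
    obtain ⟨n, hn⟩ := hV
    exact (hA n).2.1 (hVuniv ▸ hn ▸ hUA n)
  refine ⟨U, hUA, ⟨?_, hcover _ subset_rfl hinf⟩, hinf, hcover⟩
  rintro _ ⟨n, rfl⟩
  exact hUo n

end FiniteOpenGame

section Group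

variable {G : Type*} [Group G] [TopologicalSpace G] [IsTopologicalGroup G]

/-- If `x * u` is near `p` and `x * v` near `q`, with `u`, `v` near `1`, then `u * (x * u)⁻¹ * (x *
v) * v⁻¹ = 1` is near `p⁻¹ * q ≠ 1`. -/
theorem exists_translate_separated [T1Space G] {p q : G} (hpq : p ≠ q) :
    ∃ P Q U : Set G, IsOpen P ∧ p ∈ P ∧ IsOpen Q ∧ q ∈ Q ∧ IsOpen U ∧ (1 : G) ∈ U ∧
      ∀ x, Disjoint P ((x * ·) '' U) ∨ Disjoint Q ((x * ·) '' U) := by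
  have hcont : Continuous fun z : (G × G) × (G × G) => z.2.1 * z.1.1⁻¹ * (z.1.2 * z.2.2⁻¹) := by
    fun_prop
  have hmem : ∀ᶠ z in 𝓝 ((p, q), ((1 : G), (1 : G))),
      z.2.1 * z.1.1⁻¹ * (z.1.2 * z.2.2⁻¹) ≠ 1 :=
    hcont.continuousAt.eventually_ne (by simpa [inv_mul_eq_one] using hpq)
  rw [nhds_prod_eq, nhds_prod_eq, nhds_prod_eq, eventually_prod_iff] at hmem
  obtain ⟨s, hs, t, ht, hst⟩ := hmem
  obtain ⟨s1, hs1, s2, hs2, hs12⟩ := eventually_prod_iff.1 hs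
  obtain ⟨t1, ht1, t2, ht2, ht12⟩ := eventually_prod_iff.1 ht
  obtain ⟨P, hP, hPo, hpP⟩ := mem_nhds_iff.1 hs1
  obtain ⟨Q, hQ, hQo, hqQ⟩ := mem_nhds_iff.1 hs2
  obtain ⟨U, hU, hUo, h1U⟩ := mem_nhds_iff.1 (ht1.and ht2)
  refine ⟨P, Q, U, hPo, hpP, hQo, hqQ, hUo, h1U, fun x => ?_⟩
  by_contra! h
  obtain ⟨h1, h2⟩ := h
  obtain ⟨_, hp', u, hu, rfl⟩ := not_disjoint_iff.1 h1
  obtain ⟨_, hq', v, hv, rfl⟩ := not_disjoint_iff.1 h2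
  refine hst (hs12 (hP hp') (hQ hq')) (ht12 (hU hu).1 (hU hv).2) ?_
  dsimp only
  group

/-- One step of a Cantor scheme of open sets meeting a set `B` without isolated points. -/
theorem exists_refinement_avoiding_translates [T0Space G] {B : Set G}
    (hB : ∀ O, IsOpen O → ∀ x ∈ O ∩ B, ∃ y ∈ O ∩ B, y ≠ x)
    {𝓕 : Set (Set G)} (hfin : 𝓕.Finite) (h𝓕 : ∀ O ∈ 𝓕, IsOpen O ∧ (O ∩ B).Nonempty) :
    ∃ (U : Set G) (𝓕' : Set (Set G)), (IsOpen U ∧ (1 : G) ∈ U) ∧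
      (𝓕'.Finite ∧ ∀ O ∈ 𝓕', IsOpen O ∧ (O ∩ B).Nonempty) ∧
      ∀ O ∈ 𝓕, ∀ x, ∃ O' ∈ 𝓕', closure O' ⊆ O ∧ Disjoint O' ((x * ·) '' U) := by
  have key : ∀ O ∈ 𝓕, ∃ P Q U : Set G, (IsOpen P ∧ (P ∩ B).Nonempty) ∧
      (IsOpen Q ∧ (Q ∩ B).Nonempty) ∧ closure P ⊆ O ∧ closure Q ⊆ O ∧ IsOpen U ∧ (1 : G) ∈ U ∧
      ∀ x, Disjoint P ((x * ·) '' U) ∨ Disjoint Q ((x * ·) '' U) := by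
    intro O hO
    obtain ⟨hOo, p, hp⟩ := h𝓕 O hO
    obtain ⟨q, hq, hqp⟩ := hB O hOo p hp
    obtain ⟨P, Q, U, hPo, hpP, hQo, hqQ, hUo, h1U, hsep⟩ := exists_translate_separated hqp.symm
    have shrink : ∀ r ∈ O, ∃ R : Set G, IsOpen R ∧ r ∈ R ∧ closure R ⊆ O := by
      intro r hr
      obtain ⟨N, hN, hNc, hNO⟩ := exists_mem_nhds_isClosed_subset (hOo.mem_nhds hr)
      exact ⟨interior N, isOpen_interior, mem_interior_iff_mem_nhds.2 hN,
        (closure_minimal interior_subset hNc).trans hNO⟩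
    obtain ⟨R, hRo, hpR, hRO⟩ := shrink p hp.1
    obtain ⟨S, hSo, hqS, hSO⟩ := shrink q hq.1
    exact ⟨P ∩ R, Q ∩ S, U, ⟨hPo.inter hRo, p, ⟨hpP, hpR⟩, hp.2⟩,
      ⟨hQo.inter hSo, q, ⟨hqQ, hqS⟩, hq.2⟩, (closure_mono inter_subset_right).trans hRO,
      (closure_mono inter_subset_right).trans hSO, hUo, h1U, fun x =>
      (hsep x).imp (fun h => h.mono_left inter_subset_left) fun h => h.mono_left inter_subset_left⟩
  choose! P Q U hP hQ hPO hQO hUo h1U hsep using key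
  refine ⟨⋂ O ∈ 𝓕, U O, P '' 𝓕 ∪ Q '' 𝓕, ⟨hfin.isOpen_biInter hUo, mem_iInter₂.2 h1U⟩,
    ⟨(hfin.image P).union (hfin.image Q), ?_⟩, ?_⟩
  · rintro _ (⟨O, hO, rfl⟩ | ⟨O, hO, rfl⟩)
    exacts [hP O hO, hQ O hO]
  · intro O hO x
    have hsub : (x * ·) '' (⋂ O ∈ 𝓕, U O) ⊆ (x * ·) '' U O := image_mono (biInter_subset_of_mem hO)
    rcases hsep O hO x with h | h
    · exact ⟨P O, Or.inl ⟨O, hO, rfl⟩, hPO O hO, h.mono_right hsub⟩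
    · exact ⟨Q O, Or.inr ⟨O, hO, rfl⟩, hQO O hO, h.mono_right hsub⟩

/-- In a Rothberger-bounded group every nonempty compact set has an isolated point. -/
theorem not_perfect_of_selectionS1_nbdCovers [T0Space G]
    (hG : SelectionS1 (nbdCovers G) (openCovers G)) {B : Set G} (hBc : IsCompact B)
    (hBne : B.Nonempty) (hB : ∀ O, IsOpen O → ∀ x ∈ O ∩ B, ∃ y ∈ O ∩ B, y ≠ x) : False := by
  let Family := {𝓕 : Set (Set G) // 𝓕.Finite ∧ ∀ O ∈ 𝓕, IsOpen O ∧ (O ∩ B).Nonempty}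
  have step : ∀ 𝓕 : Family, ∃ (U : Set G) (𝓕' : Family), (IsOpen U ∧ (1 : G) ∈ U) ∧
      ∀ O ∈ 𝓕.1, ∀ x, ∃ O' ∈ 𝓕'.1, closure O' ⊆ O ∧ Disjoint O' ((x * ·) '' U) := by
    intro 𝓕
    obtain ⟨U, 𝓕', hU, h𝓕', h⟩ := exists_refinement_avoiding_translates hB 𝓕.2.1 𝓕.2.2
    exact ⟨U, ⟨𝓕', h𝓕'⟩, hU, h⟩
  choose U next hU hnext using step
  let 𝓕₀ : Family := ⟨{univ}, finite_singleton _, by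
    rintro _ rfl
    exact ⟨isOpen_univ, by simpa using hBne⟩⟩
  let 𝓕 : ℕ → Family := fun n => next^[n] 𝓕₀
  have h𝓕succ : ∀ n, 𝓕 (n + 1) = next (𝓕 n) := fun n => Function.iterate_succ_apply' _ _ _
  -- Each level keeps all branches, so these covers are fixed before the branch is chosen from `b`.
  obtain ⟨b, hb, -, hcov⟩ := hG (fun n => leftTranslates (U (𝓕 n)))
    fun n => ⟨U (𝓕 n), (hU _).1, (hU _).2, rfl⟩
  choose x hx using hb
  have hsel : ∀ n, ∀ O : (𝓕 n).1, ∃ O' : (𝓕 (n + 1)).1,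
      closure O'.1 ⊆ O.1 ∧ Disjoint O'.1 (b n) := by
    rintro n ⟨O, hO⟩
    obtain ⟨O', hO', h1, h2⟩ := hnext (𝓕 n) O hO (x n)
    exact ⟨⟨O', h𝓕succ n ▸ hO'⟩, h1, hx n ▸ h2⟩
  choose sel hsel1 hsel2 using hsel
  let O : (n : ℕ) → (𝓕 n).1 := fun n =>
    Nat.rec (motive := fun n => (𝓕 n).1) ⟨univ, rfl⟩ (fun n O => sel n O) n
  have hne : (⋂ n, B ∩ closure (O n).1).Nonempty := by
    refine IsCompact.nonempty_iInter_of_sequence_nonempty_isCompact_isClosed _ (fun n => ?_)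
      (fun n => ?_) (hBc.inter_right isClosed_closure)
      (fun n => hBc.isClosed.inter isClosed_closure)
    · exact inter_subset_inter_right _ ((hsel1 n (O n)).trans subset_closure)
    · obtain ⟨y, hy, hyB⟩ := ((𝓕 n).2.2 _ (O n).2).2
      exact ⟨y, hyB, subset_closure hy⟩
  obtain ⟨y, hy⟩ := hne
  obtain ⟨_, ⟨n, rfl⟩, hyn⟩ : y ∈ ⋃₀ range b := hcov ▸ mem_univ y
  -- Only closures are known to contain `y`, so one level deeper is used.
  have hyO : y ∈ (O (n + 1)).1 := hsel1 (n + 1) (O (n + 1)) (mem_iInter.1 hy (n + 2)).2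
  exact disjoint_left.1 (hsel2 n (O n)) hyO hyn

end Group

theorem proposition16 (G : Type*) [Group G] [TopologicalSpace G] [IsTopologicalGroup G]
    [T0Space G] [SigmaCompactSpace G]
    (hG : SelectionS1 (nbdCovers G) (openCovers G)) :
    SelectionS1 (omegaCovers G) (gammaCovers G) := by
  refine selectionS1_omega_gamma_of_winnable ?_
  rw [← iUnion_compactCovering G]
  refine Winnable.iUnion fun n => ?_
  by_contra hW
  obtain ⟨B, hBc, hBne, hB⟩ :=
    (isCompact_compactCovering G n).exists_perfect_of_not_winnable hW
  exact not_perfect_of_selectionS1_nbdCovers hG hBc hBne hB
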